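/- All graphs are finite and simple. For a graph $G$ let $\deg(u)$ be the degree of $u$ and $S_u=\sum_{v\in N_G(u)}\deg(v)$, and put $$ABC(G)=\sum_{uv\in E(G)}\sqrt{\frac{\deg(u)+\deg(v)-2}{\deg(u)\deg(v)}},\qquad GA(G)=\sum_{uv\in E(G)}\frac{2\sqrt{\deg(u)\deg(v)}}{\deg(u)+\deg(v)},$$ $$ABC_4(G)=\sum_{uv\in E(G)}\sqrt{\frac{S_u+S_v-2}{S_uS_v}},\qquad GA_5(G)=\sum_{uv\in E(G)}\frac{2\sqrt{S_uS_v}}{S_u+S_v}.$$ The planar octahedron network $POH(n)$ is constructed as follows. Start from the honeycomb network of dimension $n$ (a central hexagon surrounded by $n-1$ layers of hexagons), whose vertices are called silicon vertices. Place an oxide vertex on each of its edges and attach one further oxide vertex at each silicon vertex of degree two, so that every silicon vertex has exactly three oxide neighbours; join these three to each other. The silicon vertex and its three oxide neighbours form a silicate cell, drawn with the silicon vertex in the middle, and the whole graph is the silicate network of dimension $n$. For each of the three triangular faces (the silicon vertex and two of its oxide neighbours) of each cell add a new centroid vertex, joined to the two oxide vertices of that face; join the three centroid vertices of each cell to each other;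 finally delete all silicon vertices. **Theorem.** Let $G\cong POH(n)$. Then, for every $n\in\mathbb{N}$, $$ABC(G)=\tfrac34 n\bigl(4\sqrt6-2\sqrt{14}+3(4\sqrt5+2\sqrt6+\sqrt{14})n\bigr),\qquad GA(G)=12(3+2\sqrt2)n^2,$$ and, for every $n\ge 2$, $$\begin{aligned}ABC_4(G)=\tfrac1{440}\bigl(&264\sqrt{29}+88\sqrt{930}+24\sqrt{2255}+5280(n-1)+60\sqrt{330}(n-1)+24\sqrt{3410}(n-1)\\&+165\sqrt{94}(n-1)^2+528\sqrt{35}\,n+132\sqrt{38}\,n+330\sqrt{46}(n-1)n\\&+60\sqrt{86}(2n-3)+220\sqrt{35}(2-5n+3n^2)\bigr),\end{aligned}$$ $$\begin{aligned}GA_5(G)={}&8\sqrt2+6\sqrt{15}+\tfrac87\sqrt{110}+\tfrac{48}{23}\sqrt{33}(n-1)+\tfrac32\sqrt{55}(n-1)+\tfrac{96}{17}\sqrt{66}(n-1)\\&-36n+\tfrac{48}{11}\sqrt{30}\,n+36n^2+8\sqrt2(2-5n+3n^2).\end{aligned}$$ -/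

import Mathlib

/-! ### Degree based topological indices of a finite simple graph -/

section Indices

variable {V : Type*} [Fintype V]

open Classical in
/-- The degree of a vertex, as a real number. -/
noncomputable def vdeg (G : SimpleGraph V) (u : V) : ℝ := (G.degree u : ℝ)

open Classical in
/-- `S_u`: the sum of the degrees of the neighbours of `u`. -/
noncomputable def nbrDegSum (G : SimpleGraph V) (u : V) : ℝ :=
  ∑ v ∈ G.neighborFinset u, vdeg G v

open Classical in
/-- The atom-bond connectivity index. -/
noncomputable def abcIndex (G : SimpleGraph V) : ℝ :=
  ∑ e ∈ G.edgeFinset, Sym2.lift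
    ⟨fun u v => Real.sqrt ((vdeg G u + vdeg G v - 2) / (vdeg G u * vdeg G v)),
      fun u v => by dsimp only; rw [add_comm (vdeg G u), mul_comm (vdeg G u)]⟩ e

open Classical in
/-- The geometric-arithmetic index. -/
noncomputable def gaIndex (G : SimpleGraph V) : ℝ :=
  ∑ e ∈ G.edgeFinset, Sym2.lift
    ⟨fun u v => 2 * Real.sqrt (vdeg G u * vdeg G v) / (vdeg G u + vdeg G v),
      fun u v => by dsimp only; rw [add_comm (vdeg G u), mul_comm (vdeg G u)]⟩ e

open Classical in
/-- The fourth version of the atom-bond connectivity index. -/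
noncomputable def abc4Index (G : SimpleGraph V) : ℝ :=
  ∑ e ∈ G.edgeFinset, Sym2.lift
    ⟨fun u v => Real.sqrt
        ((nbrDegSum G u + nbrDegSum G v - 2) / (nbrDegSum G u * nbrDegSum G v)),
      fun u v => by dsimp only; rw [add_comm (nbrDegSum G u), mul_comm (nbrDegSum G u)]⟩ e

open Classical in
/-- The fifth version of the geometric-arithmetic index. -/
noncomputable def ga5Index (G : SimpleGraph V) : ℝ :=
  ∑ e ∈ G.edgeFinset, Sym2.lift
    ⟨fun u v => 2 * Real.sqrt (nbrDegSum G u * nbrDegSum G v) /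
        (nbrDegSum G u + nbrDegSum G v),
      fun u v => by dsimp only; rw [add_comm (nbrDegSum G u), mul_comm (nbrDegSum G u)]⟩ e

end Indices

/-! ### The honeycomb network -/

/-- Vertices of the honeycomb network of dimension `n`, in the usual three-coordinate addressing:
integer triples with entries in `[-n+1, n]` whose sum is `1` or `2`.  The hexagon centred at a
triple `c` of sum `0` consists of the six points `c + ε`, `ε ∈ {0,1}³` not constant, and the
network is the union of the hexagons with centres `|c i| ≤ n - 1`: one central hexagon surrounded
by `n - 1` layers. -/
def HoneycombVertex (n : ℕ) : Type :=
  {p : Fin 3 → ℤ // (∀ i, -(n : ℤ) + 1 ≤ p i ∧ p i ≤ n) ∧ (∑ i, p i = 1 ∨ ∑ i, p i = 2)}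

/-- The honeycomb network of dimension `n`: two vertices are adjacent when they differ in exactly
one coordinate, and there by one. -/
def honeycomb (n : ℕ) : SimpleGraph (HoneycombVertex n) where
  Adj p q := ∃ i, |p.1 i - q.1 i| = 1 ∧ ∀ j, j ≠ i → p.1 j = q.1 j
  symm := ⟨fun p q ⟨i, h, h'⟩ => ⟨i, by rw [abs_sub_comm]; exact h, fun j hj => (h' j hj).symm⟩⟩
  loopless := ⟨fun p ⟨i, h, _⟩ => by simp at h⟩

/-! ### Silicate networks -/

section Silicate

variable {V : Type*} (H : SimpleGraph V)

/-- Oxide vertices over a honeycomb `H` of silicon vertices: one subdividing each edge of `H`, and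
one pendant at each vertex of degree two. -/
abbrev Oxide : Type _ := H.edgeSet ⊕ {v : V // (H.neighborSet v).ncard = 2}

variable {H}

/-- The oxide vertex `o` lies in the silicate cell of the silicon vertex `s`. -/
def InCell (s : V) : Oxide H → Prop
  | .inl e => s ∈ (e : Sym2 V)
  | .inr t => t.1 = s

variable (H)

/-- The silicate network over `H`: each silicon vertex (left summand) is joined to the oxide
vertices of its cell, and these are joined to each other. -/
def silicate : SimpleGraph (V ⊕ Oxide H) where
  Adj
    | .inl _, .inl _ => False
    | .inl s, .inr o => InCell s o
    | .inr o, .inl s => InCell s o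
    | .inr o, .inr o' => o ≠ o' ∧ ∃ s, InCell s o ∧ InCell s o'
  symm := ⟨by
    rintro (s | o) (s' | o') h
    · exact h
    · exact h
    · exact h
    · exact ⟨h.1.symm, h.2.imp fun _ hs => hs.symm⟩⟩
  loopless := ⟨by
    rintro (s | o) h
    · exact h
    · exact h.1 rfl⟩

/-- A triangular face of a silicate cell (drawn with its silicon vertex in the middle): the silicon
vertex together with two of the oxide vertices adjacent to it. -/
@[ext]
structure TriFace where
  /-- the silicon vertex of the face -/
  silicon : V
  /-- the two oxide vertices of the face -/
  oxides : Finset (Oxide H)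
  card_oxides : oxides.card = 2
  adj_silicon : ∀ o ∈ oxides, (silicate H).Adj (.inl silicon) (.inr o)

/-- The octahedron network over `H`.  Its vertices are the oxide vertices of the silicate network
and one centroid vertex for each triangular face (the silicon vertices are removed).  The silicate
edges between oxide vertices are kept, a centroid is joined to the oxide vertices of its face, and
the centroids of the same silicate cell are joined to each other. -/
def octahedronNetwork : SimpleGraph (Oxide H ⊕ TriFace H) where
  Adj
    | .inl o, .inl o' => (silicate H).Adj (.inr o) (.inr o')
    | .inl o, .inr f => o ∈ f.oxides
    | .inr f, .inl o => o ∈ f.oxides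
    | .inr f, .inr f' => f ≠ f' ∧ f.silicon = f'.silicon
  symm := ⟨by
    rintro (o | f) (o' | f') h
    · exact SimpleGraph.Adj.symm h
    · exact h
    · exact h
    · exact ⟨h.1.symm, h.2.symm⟩⟩
  loopless := ⟨by
    rintro (o | f) h
    · exact (silicate H).loopless.irrefl _ h
    · exact h.1 rfl⟩

end Silicate

/-- The planar octahedron network `POH(n)`. -/
abbrev POH (n : ℕ) : SimpleGraph (Oxide (honeycomb n) ⊕ TriFace (honeycomb n)) :=
  octahedronNetwork (honeycomb n)

/-! ### Finiteness of the networks -/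

instance HoneycombVertex.finite (n : ℕ) : Finite (HoneycombVertex n) := by
  have h : {p : Fin 3 → ℤ | ∀ i, p i ∈ Set.Icc (-(n : ℤ) + 1) n}.Finite :=
    Set.Finite.pi' fun _ => Set.finite_Icc _ _
  exact (h.subset (t := {p : Fin 3 → ℤ | (∀ i, -(n : ℤ) + 1 ≤ p i ∧ p i ≤ n) ∧
    (∑ i, p i = 1 ∨ ∑ i, p i = 2)}) fun p hp => hp.1).to_subtype

instance TriFace.finite {V : Type*} [Finite V] (H : SimpleGraph V) : Finite (TriFace H) :=
  Finite.of_injective (fun f : TriFace H => (f.silicon, f.oxides)) fun f g h => by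
    have h' := Prod.ext_iff.1 h
    exact TriFace.ext h'.1 h'.2

/-!
The six oxide and centroid vertices of a silicate cell span an octahedron, and every edge of the
network lies in exactly one of these octahedra, so a sum over the edges is a sum over the silicon
vertices `s` of sums over twelve edges. Reflecting the silicon vertices with coordinate sum `2` by
`p ↦ 1 - p` gives reduced coordinates with sum `1` and values between `1 - n` and `n`. Centroids
have degree `4`, and the oxide vertex in direction `i` has degree `4` if the `i`-th
reduced coordinate is `n` and degree `8` otherwise. Hence the degrees in a cell depend, up to
rotation, only on whether some reduced coordinate equals `n`, and for `2 ≤ n` the neighbour degree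
sums depend, up to symmetry, only on that and on whether some reduced coordinate equals `1 - n`. The
four indices therefore reduce to counting the silicon vertices of each kind, where the reflection
contributes a factor `2` and the rotation of the coordinates a factor `3`.
-/

/-! ### Graphs decomposed into octahedra -/

lemma eq_or_eq_add_one_or_eq_add_two (i j : Fin 3) : j = i ∨ j = i + 1 ∨ j = i + 2 := by
  decide +revert

lemma eq_or_eq_add_one_or_eq_add_one (i j : Fin 3) : i = j ∨ j = i + 1 ∨ i = j + 1 := by
  decide +revert

section OctahedronSum

variable {α β M : Type*} [AddCommMonoid M]

/-- The sum of `f` over the twelve edges of an octahedron with corners `a 0, a 1, a 2` and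
`b 0, b 1, b 2`, where `a i` is opposite to `b i`: every edge joins a corner of index `i` to one of
index `i + 1` for exactly one `i`. -/
def octahedronSum (f : Sym2 α → M) (a b : Fin 3 → α) : M :=
  ∑ i, (f s(a i, a (i + 1)) + f s(b i, b (i + 1)) + f s(a i, b (i + 1)) + f s(b i, a (i + 1)))

lemma octahedronSum_map (f : Sym2 β → M) (w : α → β) (a b : Fin 3 → α) :
    octahedronSum (fun e => f (e.map w)) a b =
      octahedronSum f (fun i => w (a i)) (fun i => w (b i)) := rfl

lemma octahedronSum_eq_rotate (f : Sym2 α → M) (a b : Fin 3 → α) (i : Fin 3) :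
    octahedronSum f a b =
      octahedronSum f ![a i, a (i + 1), a (i + 2)] ![b i, b (i + 1), b (i + 2)] := by
  have vec (c : Fin 3 → α) : ![c i, c (i + 1), c (i + 2)] = fun j => c (i + j) := by
    ext j
    fin_cases j <;> simp
  simp only [octahedronSum, vec, ← add_assoc]
  exact (Equiv.sum_comp (Equiv.addLeft i) _).symm

lemma octahedronSum_swap (f : Sym2 α → M) (a₀ a₁ a₂ b₀ b₁ b₂ : α) :
    octahedronSum f ![a₀, a₁, a₂] ![b₀, b₁, b₂] =
      octahedronSum f ![a₀, a₂, a₁] ![b₀, b₂, b₁] := by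
  refine Fintype.sum_equiv (Equiv.subLeft 2) _ _ fun i => ?_
  fin_cases i <;> simp [Sym2.eq_swap, add_right_comm]

end OctahedronSum

/-- A decomposition of the edges of `G` into octahedra (cells) indexed by `S`, as it arises for
octahedron networks. The corners of a cell are indexed by `Bool × Fin 3`; two corners are opposite
when they have the same second entry, and joined by an edge otherwise. An inner corner `(true, i)`
belongs to one cell only, while the outer corner `(false, i)` of the cell `s` is also the outer
corner `(false, i)` of the cell `nbr s i`, if there is one. -/
structure CellDecomposition {W : Type*} (G : SimpleGraph W) (S : Type*) where
  /-- the corners of the cells -/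
  corner : S → Bool × Fin 3 → W
  /-- the cell that shares the corner `(false, i)` with a given cell -/
  nbr : S → Fin 3 → Option S
  adj_iff : ∀ u v, G.Adj u v ↔ ∃ s x y, x.2 ≠ y.2 ∧ corner s x = u ∧ corner s y = v
  corner_eq_iff : ∀ s t x y, corner s x = corner t y ↔
    x = y ∧ (s = t ∨ (x.1 = false ∧ nbr s x.2 = some t))
  nbr_ne : ∀ s i, nbr s i ≠ some s
  nbr_inj : ∀ {s i j t}, nbr s i = some t → nbr s j = some t → i = j

namespace CellDecomposition

variable {W S M : Type*} [AddCommMonoid M] {G : SimpleGraph W}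

/-- Transport of a cell decomposition along a graph isomorphism. -/
def ofIso {W' : Type*} {G' : SimpleGraph W'} (D : CellDecomposition G S) (e : G' ≃g G) :
    CellDecomposition G' S where
  corner s x := e.symm (D.corner s x)
  nbr := D.nbr
  adj_iff u v := by
    rw [← e.map_adj_iff, D.adj_iff]
    simp only [RelIso.symm_apply_eq]
  corner_eq_iff s t x y := by
    rw [e.symm.injective.eq_iff, D.corner_eq_iff]
  nbr_ne := D.nbr_ne
  nbr_inj := D.nbr_inj

variable (D : CellDecomposition G S)

lemma corner_injective (s : S) : Function.Injective (D.corner s) :=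
  fun _ _ h => ((D.corner_eq_iff _ _ _ _).1 h).1

lemma adj_corner (s : S) {x y : Bool × Fin 3} (h : x.2 ≠ y.2) :
    G.Adj (D.corner s x) (D.corner s y) :=
  (D.adj_iff _ _).2 ⟨s, x, y, h, rfl, rfl⟩

lemma eq_of_corner_eq_corner {s t : S} {x x' y y' : Bool × Fin 3} (h : x.2 ≠ y.2)
    (hx : D.corner s x = D.corner t x') (hy : D.corner s y = D.corner t y') :
    s = t ∧ x = x' ∧ y = y' := by
  rw [D.corner_eq_iff] at hx hy
  refine ⟨?_, hx.1, hy.1⟩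
  rcases hx.2 with rfl | ⟨-, hs⟩
  · rfl
  rcases hy.2 with rfl | ⟨-, ht⟩
  · rfl
  exact absurd (D.nbr_inj hs ht) h

lemma sum_edgeFinset [Fintype G.edgeSet] [Fintype S] (f : Sym2 W → M) :
    ∑ e ∈ G.edgeFinset, f e =
      ∑ s, octahedronSum f (fun i => D.corner s (false, i)) (fun i => D.corner s (true, i)) := by
  have expand (s : S) : octahedronSum f (fun i => D.corner s (false, i))
      (fun i => D.corner s (true, i)) = ∑ p : Fin 3 × Bool × Bool,
        f s(D.corner s (p.2.1, p.1), D.corner s (p.2.2, p.1 + 1)) := by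
    simp only [octahedronSum, Fintype.sum_prod_type, Fintype.sum_bool]
    exact Finset.sum_congr rfl fun i _ => by abel
  have succ_ne (i : Fin 3) : i ≠ i + 1 := by decide +revert
  have succ_succ_ne (i : Fin 3) : i ≠ i + 1 + 1 := by decide +revert
  simp only [expand, ← Fintype.sum_prod_type']
  symm
  refine Finset.sum_bij
    (fun p _ => s(D.corner p.1 (p.2.2.1, p.2.1), D.corner p.1 (p.2.2.2, p.2.1 + 1))) ?_ ?_ ?_ ?_
  · rintro ⟨s, i, b, c⟩ -
    exact SimpleGraph.mem_edgeFinset.2 (D.adj_corner s (succ_ne i))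
  · rintro ⟨s, i, b, c⟩ - ⟨t, j, b', c'⟩ - h
    rcases Sym2.eq_iff.1 h with ⟨h₁, h₂⟩ | ⟨h₁, h₂⟩
    · obtain ⟨rfl, hx, hy⟩ := D.eq_of_corner_eq_corner (succ_ne i) h₁ h₂
      cases hx
      cases hy
      rfl
    · obtain ⟨-, hx, hy⟩ := D.eq_of_corner_eq_corner (succ_ne i) h₁ h₂
      have hi : i = j + 1 := congrArg Prod.snd hx
      have hj : i + 1 = j := congrArg Prod.snd hy
      exact absurd (hi.trans (by rw [hj])) (succ_succ_ne i)
  · intro e he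
    induction e with | _ u v
    obtain ⟨s, ⟨b, i⟩, ⟨c, j⟩, hij, rfl, rfl⟩ := (D.adj_iff u v).1 (SimpleGraph.mem_edgeFinset.1 he)
    rcases (eq_or_eq_add_one_or_eq_add_one i j).resolve_left hij with rfl | rfl
    · exact ⟨⟨s, i, b, c⟩, Finset.mem_univ _, rfl⟩
    · exact ⟨⟨s, j, c, b⟩, Finset.mem_univ _, Sym2.eq_swap⟩
  · exact fun _ _ => rfl

/-- The link of a corner with index `i` in the cell `s`: the four corners that are neither that
corner nor opposite to it. -/
def link (s : S) (i : Fin 3) : Finset W :=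
  ({x | x.2 ≠ i} : Finset (Bool × Fin 3)).map ⟨D.corner s, D.corner_injective s⟩

lemma mem_link {s : S} {i : Fin 3} {v : W} :
    v ∈ D.link s i ↔ ∃ x : Bool × Fin 3, x.2 ≠ i ∧ D.corner s x = v := by
  simp [link]

lemma sum_link (f : W → M) (s : S) (i : Fin 3) :
    ∑ v ∈ D.link s i, f v = f (D.corner s (true, i + 1)) + f (D.corner s (true, i + 2)) +
      (f (D.corner s (false, i + 1)) + f (D.corner s (false, i + 2))) := by
  have others : ({j | j ≠ i} : Finset (Fin 3)) = {i + 1, i + 2} := by decide +revert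
  have ne : i + 1 ≠ i + 2 := by decide +revert
  have sum_ne (g : Fin 3 → M) : ∑ j, (if j ≠ i then g j else 0) = g (i + 1) + g (i + 2) := by
    rw [← Finset.sum_filter, others, Finset.sum_pair ne]
  rw [link, Finset.sum_map, Finset.sum_filter, Fintype.sum_prod_type, Fintype.sum_bool]
  exact congrArg₂ (· + ·) (sum_ne _) (sum_ne _)

lemma disjoint_link {s t : S} {i : Fin 3} (h : D.nbr s i = some t) :
    Disjoint (D.link s i) (D.link t i) := by
  rw [Finset.disjoint_left]
  intro v hs ht
  obtain ⟨x, hx, rfl⟩ := D.mem_link.1 hs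
  obtain ⟨y, -, hxy⟩ := D.mem_link.1 ht
  have hc : D.corner s (false, i) = D.corner t (false, i) :=
    (D.corner_eq_iff _ _ _ _).2 ⟨rfl, .inr ⟨rfl, h⟩⟩
  obtain ⟨rfl, -, -⟩ := D.eq_of_corner_eq_corner hx hxy.symm hc
  exact D.nbr_ne s i h

lemma adj_corner_iff {s : S} {x : Bool × Fin 3} {v : W} : G.Adj (D.corner s x) v ↔
    v ∈ D.link s x.2 ∨ x.1 = false ∧ ∃ t, D.nbr s x.2 = some t ∧ v ∈ D.link t x.2 := by
  simp only [mem_link]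
  constructor
  · intro h
    obtain ⟨t, x', y, hxy, hx, rfl⟩ := (D.adj_iff _ _).1 h
    obtain ⟨rfl, rfl | ⟨hb, ht⟩⟩ := (D.corner_eq_iff _ _ _ _).1 hx.symm
    · exact .inl ⟨y, hxy.symm, rfl⟩
    · exact .inr ⟨hb, t, ht, y, hxy.symm, rfl⟩
  · rintro (⟨y, hy, rfl⟩ | ⟨hb, t, ht, y, hy, rfl⟩)
    · exact D.adj_corner s hy.symm
    · rw [(D.corner_eq_iff s t x x).2 ⟨rfl, .inr ⟨hb, ht⟩⟩]
      exact D.adj_corner t hy.symm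

lemma sum_neighborFinset_inner (f : W → M) (s : S) (i : Fin 3)
    [Fintype (G.neighborSet (D.corner s (true, i)))] :
    ∑ v ∈ G.neighborFinset (D.corner s (true, i)), f v = ∑ v ∈ D.link s i, f v := by
  congr 1
  ext v
  simp [adj_corner_iff]

lemma sum_neighborFinset_outer (f : W → M) (s : S) (i : Fin 3)
    [Fintype (G.neighborSet (D.corner s (false, i)))] :
    ∑ v ∈ G.neighborFinset (D.corner s (false, i)), f v =
      ∑ v ∈ D.link s i, f v + (D.nbr s i).elim 0 fun t => ∑ v ∈ D.link t i, f v := by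
  cases h : D.nbr s i with
  | none =>
    have : G.neighborFinset (D.corner s (false, i)) = D.link s i := by
      ext v
      simp [adj_corner_iff, h]
    rw [this, Option.elim_none, add_zero]
  | some t =>
    have : G.neighborFinset (D.corner s (false, i)) =
        (D.link s i).disjUnion (D.link t i) (D.disjoint_link h) := by
      ext v
      simp [adj_corner_iff, h]
    rw [this, Finset.sum_disjUnion, Option.elim_some]

/-- The degree of the outer corner `(false, i)` of the cell `s`. -/
def outerDeg (s : S) (i : Fin 3) : ℝ := (D.nbr s i).elim 4 fun _ => 8

/-- The sum of the degrees of the vertices in the link of a corner with index `i` of `s`. -/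
def linkDegSum (s : S) (i : Fin 3) : ℝ := 8 + D.outerDeg s (i + 1) + D.outerDeg s (i + 2)

variable [Fintype W]

lemma vdeg_inner (s : S) (i : Fin 3) : vdeg G (D.corner s (true, i)) = 4 := by
  classical
  rw [vdeg, ← SimpleGraph.card_neighborFinset_eq_degree, Finset.cast_card,
    D.sum_neighborFinset_inner, D.sum_link]
  norm_num

lemma vdeg_outer (s : S) (i : Fin 3) : vdeg G (D.corner s (false, i)) = D.outerDeg s i := by
  classical
  rw [vdeg, ← SimpleGraph.card_neighborFinset_eq_degree, Finset.cast_card,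
    D.sum_neighborFinset_outer, outerDeg]
  cases D.nbr s i <;> simp only [Option.elim, sum_link] <;> norm_num

lemma sum_vdeg_link (s : S) (i : Fin 3) : ∑ v ∈ D.link s i, vdeg G v = D.linkDegSum s i := by
  rw [sum_link, vdeg_inner, vdeg_inner, vdeg_outer, vdeg_outer, linkDegSum]
  ring

lemma nbrDegSum_inner (s : S) (i : Fin 3) :
    nbrDegSum G (D.corner s (true, i)) = D.linkDegSum s i := by
  rw [nbrDegSum, D.sum_neighborFinset_inner, sum_vdeg_link]

lemma nbrDegSum_outer (s : S) (i : Fin 3) : nbrDegSum G (D.corner s (false, i)) =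
    D.linkDegSum s i + (D.nbr s i).elim 0 fun t => D.linkDegSum t i := by
  simp only [nbrDegSum, D.sum_neighborFinset_outer, sum_vdeg_link]

end CellDecomposition

/-! ### The cells of an octahedron network -/

/-- A proper edge colouring of `H` with three colours that is missing at most one colour at each
vertex, given by the partial functions that follow the edge of a given colour. The colours number
the oxide vertices of a silicate cell. -/
structure ThreeEdgeColoring {V : Type*} (H : SimpleGraph V) where
  /-- the end of the edge of colour `i` at `s` -/
  nbr : V → Fin 3 → Option V
  adj_iff : ∀ s t, H.Adj s t ↔ ∃ i, nbr s i = some t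
  symm : ∀ {s i t}, nbr s i = some t → nbr t i = some s
  inj : ∀ {s i j t}, nbr s i = some t → nbr s j = some t → i = j
  none_unique : ∀ {s i j}, nbr s i = none → nbr s j = none → i = j

namespace ThreeEdgeColoring

variable {V : Type*} {H : SimpleGraph V} (C : ThreeEdgeColoring H)

lemma adj {s t : V} {i : Fin 3} (h : C.nbr s i = some t) : H.Adj s t :=
  (C.adj_iff s t).2 ⟨i, h⟩

lemma ncard_neighborSet (s : V) :
    (H.neighborSet s).ncard = ({i | ¬C.nbr s i = none} : Finset (Fin 3)).card := by
  have image_eq : some '' H.neighborSet s = C.nbr s '' {i | ¬C.nbr s i = none} := by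
    ext o
    cases o with
    | none => simp
    | some t => simpa [C.adj_iff] using exists_congr fun i => by simp +contextual
  have injOn : Set.InjOn (C.nbr s) {i | ¬C.nbr s i = none} := by
    intro i hi j _ hij
    obtain ⟨t, ht⟩ := Option.ne_none_iff_exists'.1 hi
    exact C.inj ht (hij.symm.trans ht)
  rw [← Set.ncard_image_of_injective _ (Option.some_injective V), image_eq, injOn.ncard_image,
    ← Set.ncard_coe_finset, Finset.coe_filter_univ]

lemma ncard_neighborSet_eq_two_iff (s : V) :
    (H.neighborSet s).ncard = 2 ↔ ∃ i, C.nbr s i = none := by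
  have le_one : ({i | C.nbr s i = none} : Finset (Fin 3)).card ≤ 1 :=
    Finset.card_le_one.2 fun i hi j hj => C.none_unique (by simpa using hi) (by simpa using hj)
  have pos_iff : 0 < ({i | C.nbr s i = none} : Finset (Fin 3)).card ↔ ∃ i, C.nbr s i = none := by
    simp [Finset.card_pos, Finset.filter_nonempty_iff]
  have add_eq := Finset.card_filter_add_card_filter_not (s := .univ) fun i => C.nbr s i = none
  rw [Finset.card_univ, Fintype.card_fin] at add_eq
  rw [C.ncard_neighborSet, ← pos_iff]
  omega

/-- The oxide vertex of the silicate cell of `s` on the edge of colour `i`, or attached to `s` in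
place of the missing colour `i`. -/
def oxide (s : V) (i : Fin 3) : Oxide H :=
  match h : C.nbr s i with
  | some t => .inl ⟨s(s, t), C.adj h⟩
  | none => .inr ⟨s, (C.ncard_neighborSet_eq_two_iff s).2 ⟨i, h⟩⟩

lemma oxide_of_some {s t : V} {i : Fin 3} (h : C.nbr s i = some t) :
    C.oxide s i = .inl ⟨s(s, t), C.adj h⟩ := by
  unfold oxide
  split
  · next t' h' =>
    obtain rfl : t' = t := Option.some.inj (h'.symm.trans h)
    rfl
  · next h' => cases h.symm.trans h'

lemma oxide_of_none {s : V} {i : Fin 3} (h : C.nbr s i = none) :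
    C.oxide s i = .inr ⟨s, (C.ncard_neighborSet_eq_two_iff s).2 ⟨i, h⟩⟩ := by
  unfold oxide
  split
  · next h' => cases h.symm.trans h'
  · rfl

lemma inCell_iff {s : V} {o : Oxide H} : InCell s o ↔ ∃ i, C.oxide s i = o := by
  constructor
  · rcases o with ⟨e, he⟩ | ⟨t, ht⟩
    · intro h
      obtain ⟨t, rfl⟩ : ∃ t, e = s(s, t) := h
      obtain ⟨i, hi⟩ := (C.adj_iff s t).1 he
      exact ⟨i, C.oxide_of_some hi⟩
    · rintro rfl
      obtain ⟨i, hi⟩ := (C.ncard_neighborSet_eq_two_iff t).1 ht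
      exact ⟨i, C.oxide_of_none hi⟩
  · rintro ⟨i, rfl⟩
    cases h : C.nbr s i with
    | none =>
      rw [C.oxide_of_none h]
      rfl
    | some t =>
      rw [C.oxide_of_some h]
      exact Sym2.mem_mk_left s t

lemma inCell_oxide (s : V) (i : Fin 3) : InCell s (C.oxide s i) :=
  C.inCell_iff.2 ⟨i, rfl⟩

lemma oxide_eq_iff {s t : V} {i j : Fin 3} :
    C.oxide s i = C.oxide t j ↔ i = j ∧ (s = t ∨ C.nbr s i = some t) := by
  constructor
  · intro h
    cases hs : C.nbr s i with
    | none =>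
      rw [C.oxide_of_none hs] at h
      cases ht : C.nbr t j with
      | none =>
        rw [C.oxide_of_none ht] at h
        obtain rfl : s = t := congrArg Subtype.val (Sum.inr.inj h)
        exact ⟨C.none_unique hs ht, .inl rfl⟩
      | some t' => cases h.trans (C.oxide_of_some ht)
    | some s' =>
      rw [C.oxide_of_some hs] at h
      cases ht : C.nbr t j with
      | none => cases h.trans (C.oxide_of_none ht)
      | some t' =>
        rw [C.oxide_of_some ht] at h
        obtain ⟨rfl, rfl⟩ | ⟨rfl, rfl⟩ := Sym2.eq_iff.1 (congrArg Subtype.val (Sum.inl.inj h))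
        · exact ⟨C.inj hs ht, .inl rfl⟩
        · exact ⟨C.inj hs (C.symm ht), .inr rfl⟩
  · rintro ⟨rfl, rfl | h⟩
    · rfl
    · rw [C.oxide_of_some h, C.oxide_of_some (C.symm h)]
      simp only [Sym2.eq_swap]

lemma oxide_injective (s : V) : Function.Injective (C.oxide s) :=
  fun _ _ h => (C.oxide_eq_iff.1 h).1

/-- The face of the silicate cell of `s` opposite to the oxide vertex with colour `i`. -/
def face (s : V) (i : Fin 3) : TriFace H where
  silicon := s
  oxides := ({j | j ≠ i} : Finset (Fin 3)).map ⟨C.oxide s, C.oxide_injective s⟩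
  card_oxides := by
    rw [Finset.card_map]
    decide +revert
  adj_silicon o ho := by
    obtain ⟨j, -, rfl⟩ := Finset.mem_map.1 ho
    exact C.inCell_oxide s j

lemma mem_oxides_face {s : V} {i : Fin 3} {o : Oxide H} :
    o ∈ (C.face s i).oxides ↔ ∃ j, j ≠ i ∧ C.oxide s j = o := by
  simp [face]

lemma oxide_mem_oxides_face {s : V} {i j : Fin 3} :
    C.oxide s j ∈ (C.face s i).oxides ↔ j ≠ i := by
  simp [mem_oxides_face, (C.oxide_injective s).eq_iff]

lemma face_eq_iff {s t : V} {i j : Fin 3} : C.face s i = C.face t j ↔ i = j ∧ s = t := by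
  constructor
  · intro h
    obtain rfl : s = t := congrArg TriFace.silicon h
    have hi : C.oxide s i ∉ (C.face s i).oxides := fun hi => C.oxide_mem_oxides_face.1 hi rfl
    rw [h, oxide_mem_oxides_face, not_ne_iff] at hi
    exact ⟨hi, rfl⟩
  · rintro ⟨rfl, rfl⟩
    rfl

lemma exists_face_eq (f : TriFace H) : ∃ i, C.face f.silicon i = f := by
  classical
  let cell : Finset (Oxide H) := Finset.univ.map ⟨C.oxide f.silicon, C.oxide_injective _⟩
  have card_cell : cell.card = 3 := Finset.card_map _
  obtain ⟨o, ho, hof⟩ := Finset.exists_mem_notMem_of_card_lt_card (s := f.oxides) (t := cell)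
    (by rw [card_cell, f.card_oxides]; norm_num)
  obtain ⟨i, -, rfl⟩ := Finset.mem_map.1 ho
  have subset : f.oxides ⊆ (C.face f.silicon i).oxides := by
    intro o h
    obtain ⟨j, rfl⟩ := C.inCell_iff.1 (f.adj_silicon o h)
    exact C.oxide_mem_oxides_face.2 fun hji => hof (hji ▸ h)
  refine ⟨i, TriFace.ext rfl (Finset.eq_of_subset_of_card_le subset ?_).symm⟩
  rw [TriFace.card_oxides, TriFace.card_oxides]

/-- The corners of the octahedron that replaces the silicate cell of `s`: its oxide vertices, and
opposite to each of them the centroid of the face that avoids it. -/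
def corner (s : V) : Bool × Fin 3 → Oxide H ⊕ TriFace H
  | (false, i) => .inl (C.oxide s i)
  | (true, i) => .inr (C.face s i)

lemma adj_corner (s : V) {x y : Bool × Fin 3} (h : x.2 ≠ y.2) :
    (octahedronNetwork H).Adj (C.corner s x) (C.corner s y) := by
  obtain ⟨_ | _, i⟩ := x <;> obtain ⟨_ | _, j⟩ := y
  · exact ⟨fun e => h (C.oxide_injective s e), s, C.inCell_oxide s i, C.inCell_oxide s j⟩
  · exact C.oxide_mem_oxides_face.2 h
  · exact C.oxide_mem_oxides_face.2 h.symm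
  · exact ⟨fun e => h (C.face_eq_iff.1 e).1, rfl⟩

lemma exists_corner_of_mem_oxides {o : Oxide H} {f : TriFace H} (h : o ∈ f.oxides) :
    ∃ s i j, i ≠ j ∧ C.corner s (false, i) = .inl o ∧ C.corner s (true, j) = .inr f := by
  obtain ⟨j, hj⟩ := C.exists_face_eq f
  rw [← hj] at h
  obtain ⟨i, hij, rfl⟩ := C.mem_oxides_face.1 h
  exact ⟨f.silicon, i, j, hij, rfl, congrArg Sum.inr hj⟩

lemma exists_corner_of_adj {u v : Oxide H ⊕ TriFace H} (h : (octahedronNetwork H).Adj u v) :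
    ∃ s x y, x.2 ≠ y.2 ∧ C.corner s x = u ∧ C.corner s y = v := by
  rcases u with o | f <;> rcases v with o' | f'
  · obtain ⟨hne, s, hs, hs'⟩ := h
    obtain ⟨i, rfl⟩ := C.inCell_iff.1 hs
    obtain ⟨j, rfl⟩ := C.inCell_iff.1 hs'
    exact ⟨s, (false, i), (false, j), fun e => hne (congrArg _ e), rfl, rfl⟩
  · obtain ⟨s, i, j, hij, ho, hf⟩ := C.exists_corner_of_mem_oxides h
    exact ⟨s, (false, i), (true, j), hij, ho, hf⟩
  · obtain ⟨s, i, j, hij, ho, hf⟩ := C.exists_corner_of_mem_oxides h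
    exact ⟨s, (true, j), (false, i), hij.symm, hf, ho⟩
  · obtain ⟨hne, hs⟩ := h
    obtain ⟨i, hi⟩ := C.exists_face_eq f
    obtain ⟨j, hj⟩ := C.exists_face_eq f'
    rw [← hs] at hj
    refine ⟨f.silicon, (true, i), (true, j), ?_, congrArg Sum.inr hi, congrArg Sum.inr hj⟩
    rintro rfl
    exact hne (hi.symm.trans hj)

/-- The decomposition of the octahedron network over `H` into octahedra, one for each vertex of
`H`. -/
def cellDecomposition : CellDecomposition (octahedronNetwork H) V where
  corner := C.corner
  nbr := C.nbr
  adj_iff u v := by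
    refine ⟨C.exists_corner_of_adj, ?_⟩
    rintro ⟨s, x, y, h, rfl, rfl⟩
    exact C.adj_corner s h
  corner_eq_iff s t x y := by
    obtain ⟨_ | _, i⟩ := x <;> obtain ⟨_ | _, j⟩ := y <;>
      simp [corner, oxide_eq_iff, face_eq_iff]
  nbr_ne s i h := (C.adj h).ne rfl
  nbr_inj := C.inj

end ThreeEdgeColoring

/-! ### Coordinates on the honeycomb network -/

lemma sum_sub_sum_of_forall_ne_eq {ι M : Type*} [Fintype ι] [AddCommGroup M] {p q : ι → M} {i : ι}
    (h : ∀ j, j ≠ i → p j = q j) : ∑ j, q j - ∑ j, p j = q i - p i := by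
  rw [← Finset.sum_sub_distrib]
  exact Fintype.sum_eq_single i fun j hj => sub_eq_zero.2 (h j hj).symm

namespace HoneycombVertex

variable {n : ℕ} (s t : HoneycombVertex n)

/-- The coordinates of a honeycomb vertex after the reflection `p ↦ 1 - p` of the vertices with
coordinate sum `2`. They have sum `1`, and the edge in direction `i` leaves the network exactly when
the reduced coordinate `i` has its maximal value `n`. -/
def reduced (i : Fin 3) : ℤ := if ∑ j, s.1 j = 1 then s.1 i else 1 - s.1 i

lemma reduced_mem_Icc (i : Fin 3) : s.reduced i ∈ Finset.Icc (1 - (n : ℤ)) n := by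
  have := s.2.1 i
  rw [Finset.mem_Icc, reduced]
  split_ifs <;> omega

lemma sum_reduced (i : Fin 3) : s.reduced i + s.reduced (i + 1) + s.reduced (i + 2) = 1 := by
  have sum_eq : ∑ j, s.1 j = s.1 i + s.1 (i + 1) + s.1 (i + 2) := by
    rw [Fin.sum_univ_three]
    fin_cases i <;> simp <;> ring
  have := s.2.2
  simp only [reduced]
  split_ifs <;> omega

lemma reduced_add_reduced {i j : Fin 3} (h : i ≠ j) :
    ∃ k, s.reduced i + s.reduced j + s.reduced k = 1 := by
  obtain rfl | rfl := (eq_or_eq_add_one_or_eq_add_two i j).resolve_left h.symm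
  · exact ⟨i + 2, s.sum_reduced i⟩
  · exact ⟨i + 1, by rw [add_right_comm, s.sum_reduced i]⟩

lemma eq_of_reduced_eq_max {i j : Fin 3} (hi : s.reduced i = n) (hj : s.reduced j = n) :
    i = j := by
  by_contra hij
  obtain ⟨k, hk⟩ := s.reduced_add_reduced hij
  have := Finset.mem_Icc.1 (s.reduced_mem_Icc k)
  omega

lemma eq_of_reduced_eq_min (hn : 2 ≤ n) {i j : Fin 3} (hi : s.reduced i = 1 - n)
    (hj : s.reduced j = 1 - n) : i = j := by
  by_contra hij
  obtain ⟨k, hk⟩ := s.reduced_add_reduced hij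
  have := Finset.mem_Icc.1 (s.reduced_mem_Icc k)
  omega

/-- The coordinates of the lattice point joined to `s` by an edge in direction `i`. -/
def step (i : Fin 3) : Fin 3 → ℤ :=
  Function.update s.1 i (if ∑ j, s.1 j = 1 then s.1 i + 1 else s.1 i - 1)

variable {s t}

lemma step_mem {i : Fin 3} (h : s.reduced i ≠ n) :
    (∀ j, -(n : ℤ) + 1 ≤ s.step i j ∧ s.step i j ≤ n) ∧
      (∑ j, s.step i j = 1 ∨ ∑ j, s.step i j = 2) := by
  have bounds := s.2.1
  have sum_mem := s.2.2
  constructor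
  · intro j
    obtain rfl | hj := eq_or_ne j i
    · have := bounds j
      rw [reduced] at h
      rw [step, Function.update_self]
      split_ifs at h ⊢ <;> omega
    · rw [step, Function.update_of_ne hj]
      exact bounds j
  · have sum_step : ∑ j, s.step i j - ∑ j, s.1 j = s.step i i - s.1 i :=
      sum_sub_sum_of_forall_ne_eq fun j hj => (Function.update_of_ne hj _ s.1).symm
    have step_self : s.step i i = if ∑ j, s.1 j = 1 then s.1 i + 1 else s.1 i - 1 :=
      Function.update_self ..
    split_ifs at step_self <;> omega

lemma eq_step_iff {i : Fin 3} :
    t.1 = s.step i ↔ |s.1 i - t.1 i| = 1 ∧ ∀ j, j ≠ i → s.1 j = t.1 j := by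
  rw [step, Function.eq_update_iff]
  simp only [eq_comm (a := s.1 _)]
  refine and_congr_left fun heq => ⟨fun hi => ?_, fun hi => ?_⟩
  · rw [hi]
    split_ifs <;> simp
  · have sum_sub := sum_sub_sum_of_forall_ne_eq heq
    have hs := s.2.2
    have ht := t.2.2
    rcases abs_eq_abs.1 (hi.trans abs_one.symm) with hi | hi <;> split_ifs <;> omega

lemma reduced_ne_of_eq_step {i : Fin 3} (h : t.1 = s.step i) : s.reduced i ≠ n := by
  have bounds := t.2.1 i
  rw [h, step, Function.update_self] at bounds
  rw [reduced]
  split_ifs at bounds ⊢ <;> omega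

variable (s) in
/-- The neighbour of a honeycomb vertex in direction `i`. -/
def nbr (i : Fin 3) : Option (HoneycombVertex n) :=
  if h : s.reduced i = n then none else some ⟨s.step i, step_mem h⟩

lemma nbr_eq_none_iff {i : Fin 3} : s.nbr i = none ↔ s.reduced i = n := by
  simp [nbr]

lemma nbr_eq_some_iff {i : Fin 3} :
    s.nbr i = some t ↔ |s.1 i - t.1 i| = 1 ∧ ∀ j, j ≠ i → s.1 j = t.1 j := by
  rw [← eq_step_iff, nbr]
  split_ifs with h
  · simpa using fun ht => reduced_ne_of_eq_step ht h
  · exact Option.some_inj.trans (Subtype.ext_iff.trans eq_comm)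

lemma reduced_of_nbr_eq_some {i j : Fin 3} (h : s.nbr i = some t) (hj : j ≠ i) :
    t.reduced j = 1 - s.reduced j := by
  obtain ⟨hi, heq⟩ := nbr_eq_some_iff.1 h
  have sum_sub := sum_sub_sum_of_forall_ne_eq heq
  have hs := s.2.2
  have ht := t.2.2
  simp only [reduced, heq j hj]
  rcases abs_eq_abs.1 (hi.trans abs_one.symm) with hi | hi <;> split_ifs <;> omega

end HoneycombVertex

/-- The colouring of the edges of the honeycomb network by their direction. -/
def honeycombColoring (n : ℕ) : ThreeEdgeColoring (honeycomb n) where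
  nbr := HoneycombVertex.nbr
  adj_iff s t := exists_congr fun i => HoneycombVertex.nbr_eq_some_iff.symm
  symm {s i t} h := by
    rw [HoneycombVertex.nbr_eq_some_iff] at h ⊢
    exact ⟨abs_sub_comm (s.1 i) (t.1 i) ▸ h.1, fun j hj => (h.2 j hj).symm⟩
  inj {s i j t} hi hj := by
    by_contra hij
    have ne := (HoneycombVertex.nbr_eq_some_iff.1 hi).1
    rw [(HoneycombVertex.nbr_eq_some_iff.1 hj).2 i hij, sub_self] at ne
    norm_num at ne
  none_unique {s i j} hi hj :=
    s.eq_of_reduced_eq_max (HoneycombVertex.nbr_eq_none_iff.1 hi)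
      (HoneycombVertex.nbr_eq_none_iff.1 hj)

namespace HoneycombVertex

variable {n : ℕ}

/-- The lattice points of a hexagon with sides of `n` and `n + 1` points, each given by the first
two of its three coordinates with sum `1`. -/
noncomputable def hexPoints (n : ℕ) : Finset (ℤ × ℤ) :=
  {q ∈ Finset.Icc (1 - (n : ℤ)) n ×ˢ Finset.Icc (1 - (n : ℤ)) n |
    1 - q.1 - q.2 ∈ Finset.Icc (1 - (n : ℤ)) n}

lemma mem_hexPoints {q : ℤ × ℤ} :
    q ∈ hexPoints n ↔ (1 - n ≤ q.1 ∧ q.1 ≤ n) ∧ (1 - n ≤ q.2 ∧ q.2 ≤ n) ∧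
      1 - n ≤ 1 - q.1 - q.2 ∧ 1 - q.1 - q.2 ≤ n := by
  simp only [hexPoints, Finset.mem_filter, Finset.mem_product, Finset.mem_Icc, and_assoc]

lemma reduced_mem_hexPoints (s : HoneycombVertex n) (i : Fin 3) :
    (s.reduced i, s.reduced (i + 1)) ∈ hexPoints n := by
  have h₂ := Finset.mem_Icc.1 (s.reduced_mem_Icc (i + 2))
  have sum_eq := s.sum_reduced i
  refine mem_hexPoints.2 ⟨Finset.mem_Icc.1 (s.reduced_mem_Icc i),
    Finset.mem_Icc.1 (s.reduced_mem_Icc (i + 1)), ?_⟩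
  dsimp only
  omega

lemma eq_of_reduced_eq {s t : HoneycombVertex n} {i : Fin 3}
    (hst : ∑ j, s.1 j = 1 ↔ ∑ j, t.1 j = 1) (h₀ : s.reduced i = t.reduced i)
    (h₁ : s.reduced (i + 1) = t.reduced (i + 1)) : s = t := by
  have h₂ : s.reduced (i + 2) = t.reduced (i + 2) := by
    have hs := s.sum_reduced i
    have ht := t.sum_reduced i
    omega
  refine Subtype.ext (funext fun j => ?_)
  have hj : s.reduced j = t.reduced j := by
    obtain rfl | rfl | rfl := eq_or_eq_add_one_or_eq_add_two i j <;> assumption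
  simp only [reduced, hst] at hj
  split_ifs at hj <;> omega

lemma exists_reduced_eq_of_sum_eq {x : Fin 3 → ℤ}
    (hx : ∀ j, x j ∈ Finset.Icc (1 - (n : ℤ)) n) (sum_eq : ∑ j, x j = 1) (b : Bool) :
    ∃ s : HoneycombVertex n, decide (∑ j, s.1 j = 1) = b ∧ s.reduced = x := by
  simp only [Finset.mem_Icc] at hx
  cases b with
  | true =>
    refine ⟨⟨x, fun j => ?_, .inl sum_eq⟩, decide_eq_true sum_eq, funext fun j => if_pos sum_eq⟩
    have := hx j
    omega
  | false =>
    have sum_sub : ∑ j, (1 - x j) = 2 := by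
      rw [Finset.sum_sub_distrib, sum_eq]
      rfl
    have ne_one : ∑ j, (1 - x j) ≠ 1 := by omega
    refine ⟨⟨fun j => 1 - x j, fun j => ?_, .inr sum_sub⟩, decide_eq_false ne_one,
      funext fun j => ?_⟩
    · have := hx j
      dsimp only
      omega
    · exact (if_neg ne_one).trans (sub_sub_cancel 1 (x j))

lemma exists_reduced_eq {q : ℤ × ℤ} (hq : q ∈ hexPoints n) (i : Fin 3) (b : Bool) :
    ∃ s : HoneycombVertex n,
      decide (∑ j, s.1 j = 1) = b ∧ (s.reduced i, s.reduced (i + 1)) = q := by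
  obtain ⟨h₀, h₁, h₂⟩ := mem_hexPoints.1 hq
  let x : Fin 3 → ℤ := ![q.1, q.2, 1 - q.1 - q.2]
  have hx (j : Fin 3) : x j ∈ Finset.Icc (1 - (n : ℤ)) n := by
    rw [Finset.mem_Icc]
    fin_cases j <;> assumption
  have sum_eq : ∑ j, x (j - i) = 1 := by
    refine (Equiv.sum_comp (Equiv.subRight i) x).trans ?_
    rw [Fin.sum_univ_three]
    simp [x]
  obtain ⟨s, hs, hr⟩ := exists_reduced_eq_of_sum_eq (fun j => hx (j - i)) sum_eq b
  exact ⟨s, hs, by simp [hr, x]⟩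

variable [Fintype (HoneycombVertex n)] (p : ℤ → ℤ → Prop) [DecidableRel p]

lemma card_filter_reduced (i : Fin 3) :
    ({s | p (s.reduced i) (s.reduced (i + 1))} : Finset (HoneycombVertex n)).card =
      2 * ({q ∈ hexPoints n | p q.1 q.2}).card := by
  have card_product : ((.univ : Finset Bool) ×ˢ {q ∈ hexPoints n | p q.1 q.2}).card =
      2 * ({q ∈ hexPoints n | p q.1 q.2}).card := Finset.card_product ..
  rw [← card_product]
  refine Finset.card_bij
    (fun s _ => (decide (∑ j, s.1 j = 1), s.reduced i, s.reduced (i + 1))) ?_ ?_ ?_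
  · intro s hs
    exact Finset.mem_product.2 ⟨Finset.mem_univ _,
      Finset.mem_filter.2 ⟨s.reduced_mem_hexPoints i, (Finset.mem_filter.1 hs).2⟩⟩
  · intro s _ t _ hst
    simp only [Prod.mk.injEq, decide_eq_decide] at hst
    exact eq_of_reduced_eq hst.1 hst.2.1 hst.2.2
  · rintro ⟨b, q⟩ hbq
    obtain ⟨hq, hp⟩ := Finset.mem_filter.1 (Finset.mem_product.1 hbq).2
    obtain ⟨s, rfl, rfl⟩ := exists_reduced_eq hq i b
    exact ⟨s, Finset.mem_filter.2 ⟨Finset.mem_univ s, hp⟩, rfl⟩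

lemma card_filter_exists_reduced
    (unique : ∀ (s : HoneycombVertex n) i j, p (s.reduced i) (s.reduced (i + 1)) →
      p (s.reduced j) (s.reduced (j + 1)) → i = j) :
    ({s | ∃ i, p (s.reduced i) (s.reduced (i + 1))} : Finset (HoneycombVertex n)).card =
      6 * ({q ∈ hexPoints n | p q.1 q.2}).card := by
  classical
  have eq_biUnion : ({s | ∃ i, p (s.reduced i) (s.reduced (i + 1))} : Finset (HoneycombVertex n)) =
      Finset.univ.biUnion fun i => {s | p (s.reduced i) (s.reduced (i + 1))} := by
    ext s
    simp
  rw [eq_biUnion, Finset.card_biUnion]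
  · simp only [card_filter_reduced, Finset.sum_const, Finset.card_univ, Fintype.card_fin,
      smul_eq_mul]
    ring
  · intro i _ j _ hij
    exact Finset.disjoint_filter.2 fun s _ hi hj => hij (unique s i j hi hj)

/-- The lines through the centre along the three directions cut the hexagon into three rhombi with
`n ^ 2` points each. -/
lemma card_eq : Fintype.card (HoneycombVertex n) = 6 * n ^ 2 := by
  have sign_change (s : HoneycombVertex n) : ∃ i, s.reduced i ≤ 0 ∧ 0 < s.reduced (i + 1) := by
    by_contra! h
    have h₀ := h 0
    have h₁ := h 1
    have h₂ := h 2
    have sum_eq := s.sum_reduced 0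
    simp only [Fin.isValue, zero_add, Fin.reduceAdd] at h₀ h₁ h₂ sum_eq
    omega
  have unique (s : HoneycombVertex n) (i j : Fin 3) (hi : s.reduced i ≤ 0 ∧ 0 < s.reduced (i + 1))
      (hj : s.reduced j ≤ 0 ∧ 0 < s.reduced (j + 1)) : i = j := by
    obtain rfl | rfl | rfl := eq_or_eq_add_one_or_eq_add_one i j
    · rfl
    · omega
    · omega
  have rhombus : {q ∈ hexPoints n | q.1 ≤ 0 ∧ 0 < q.2} =
      Finset.Icc (1 - (n : ℤ)) 0 ×ˢ Finset.Icc (1 : ℤ) n := by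
    ext q
    simp only [Finset.mem_filter, mem_hexPoints, Finset.mem_product, Finset.mem_Icc]
    omega
  have card_filter := card_filter_exists_reduced (fun x y => x ≤ 0 ∧ 0 < y) unique
  rw [Finset.filter_true_of_mem fun s _ => sign_change s, rhombus] at card_filter
  simpa [pow_two] using card_filter

lemma card_filter_exists_eq_max :
    ({s | ∃ i, s.reduced i = n} : Finset (HoneycombVertex n)).card = 6 * n := by
  have side : {q ∈ hexPoints n | q.1 = (n : ℤ)} = {(n : ℤ)} ×ˢ Finset.Icc (1 - (n : ℤ)) 0 := by
    ext q
    simp only [Finset.mem_filter, mem_hexPoints, Finset.mem_product, Finset.mem_Icc,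
      Finset.mem_singleton]
    omega
  rw [card_filter_exists_reduced (fun x _ => x = n) fun s i j => s.eq_of_reduced_eq_max, side]
  simp

lemma card_filter_exists_eq_min (hn : 2 ≤ n) :
    ({s | ∃ i, s.reduced i = 1 - n} : Finset (HoneycombVertex n)).card = 6 * (n + 1) := by
  have side : {q ∈ hexPoints n | q.1 = 1 - (n : ℤ)} = {1 - (n : ℤ)} ×ˢ Finset.Icc (0 : ℤ) n := by
    ext q
    simp only [Finset.mem_filter, mem_hexPoints, Finset.mem_product, Finset.mem_Icc,
      Finset.mem_singleton]
    omega
  rw [card_filter_exists_reduced (fun x _ => x = 1 - n) fun s i j => s.eq_of_reduced_eq_min hn,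
    side]
  simp

lemma card_filter_exists_eq_max_and_eq_min (hn : 2 ≤ n) :
    ({s | (∃ i, s.reduced i = n) ∧ ∃ i, s.reduced i = 1 - n} :
      Finset (HoneycombVertex n)).card = 12 := by
  have consecutive (s : HoneycombVertex n) : ((∃ i, s.reduced i = n) ∧ ∃ i, s.reduced i = 1 - n) ↔
      ∃ i, s.reduced i = n ∧ (s.reduced (i + 1) = 1 - n ∨ s.reduced (i + 1) = 0) := by
    rw [← exists_and_right]
    refine exists_congr fun i => and_congr_right fun hi => ?_
    have sum_eq := s.sum_reduced i
    constructor
    · rintro ⟨j, hj⟩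
      obtain rfl | rfl | rfl := eq_or_eq_add_one_or_eq_add_two i j <;> omega
    · rintro (h | h)
      · exact ⟨i + 1, h⟩
      · exact ⟨i + 2, by omega⟩
  have corners : {q ∈ hexPoints n | q.1 = (n : ℤ) ∧ (q.2 = 1 - (n : ℤ) ∨ q.2 = 0)} =
      ({(n : ℤ)} : Finset ℤ) ×ˢ {1 - (n : ℤ), 0} := by
    ext q
    simp only [Finset.mem_filter, mem_hexPoints, Finset.mem_product, Finset.mem_insert,
      Finset.mem_singleton]
    omega
  have ne : 1 - (n : ℤ) ≠ 0 := by omega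
  simp only [consecutive]
  rw [card_filter_exists_reduced (fun x y => x = n ∧ (y = 1 - n ∨ y = 0))
    fun s i j hi hj => s.eq_of_reduced_eq_max hi.1 hj.1, corners, Finset.card_product,
    Finset.card_singleton, Finset.card_pair ne]

end HoneycombVertex

/-! ### The edge partitions of the planar octahedron network -/

lemma sum_ite_const {S R : Type*} [Fintype S] [Ring R] (P : S → Prop) [DecidablePred P] (a b : R) :
    ∑ s, (if P s then a else b) =
      Fintype.card S * b + ({s | P s} : Finset S).card * (a - b) := by
  have split (s : S) : (if P s then a else b) = b + if P s then a - b else 0 := by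
    split_ifs <;> simp
  simp only [split, Finset.sum_add_distrib, ← Finset.sum_filter, Finset.sum_const, nsmul_eq_mul,
    Finset.card_univ]

lemma sum_ite_ite_const {S R : Type*} [Fintype S] [Ring R] (P Q : S → Prop) [DecidablePred P]
    [DecidablePred Q] (a b c d : R) :
    ∑ s, (if P s then if Q s then a else b else if Q s then c else d) =
      Fintype.card S * d + ({s | P s} : Finset S).card * (b - d) +
        ({s | Q s} : Finset S).card * (c - d) +
        ({s | P s ∧ Q s} : Finset S).card * (a - b - (c - d)) := by
  have split (s : S) : (if P s then if Q s then a else b else if Q s then c else d) =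
      (if P s then b else d) + (if Q s then c - d else 0) +
        if P s ∧ Q s then a - b - (c - d) else 0 := by
    by_cases hP : P s <;> by_cases hQ : Q s <;> simp [hP, hQ]
  simp only [split, Finset.sum_add_distrib, sum_ite_const, mul_zero, zero_add, sub_zero]

section

variable {n : ℕ} {V : Type*} {G : SimpleGraph V} (e : G ≃g POH n)

/-- The decomposition of a copy of `POH n` into octahedra. -/
def pohCells : CellDecomposition G (HoneycombVertex n) :=
  (honeycombColoring n).cellDecomposition.ofIso e

variable {s t : HoneycombVertex n} {i : Fin 3}

lemma outerDeg_pohCells (s : HoneycombVertex n) (i : Fin 3) :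
    (pohCells e).outerDeg s i = if s.reduced i = n then 4 else 8 := by
  change (s.nbr i).elim 4 (fun _ => 8) = _
  split_ifs with h
  · rw [HoneycombVertex.nbr_eq_none_iff.2 h, Option.elim_none]
  · obtain ⟨t, ht⟩ := Option.ne_none_iff_exists'.1 (mt HoneycombVertex.nbr_eq_none_iff.1 h)
    rw [ht, Option.elim_some]

lemma linkDegSum_pohCells (s : HoneycombVertex n) (i : Fin 3) :
    (pohCells e).linkDegSum s i = 8 + (if s.reduced (i + 1) = n then 4 else 8) +
      if s.reduced (i + 2) = n then 4 else 8 := by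
  rw [CellDecomposition.linkDegSum, outerDeg_pohCells, outerDeg_pohCells]

lemma linkDegSum_pohCells_of_nbr_eq_some (h : s.nbr i = some t) :
    (pohCells e).linkDegSum t i = 8 + (if s.reduced (i + 1) = 1 - n then 4 else 8) +
      if s.reduced (i + 2) = 1 - n then 4 else 8 := by
  have reflect (x : ℤ) : 1 - x = n ↔ x = 1 - n := by omega
  rw [linkDegSum_pohCells, HoneycombVertex.reduced_of_nbr_eq_some h (by simp),
    HoneycombVertex.reduced_of_nbr_eq_some h (by simp)]
  simp only [reflect]

variable [Fintype V]

lemma nbrDegSum_outer_pohCells (s : HoneycombVertex n) (i : Fin 3) :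
    nbrDegSum G ((pohCells e).corner s (false, i)) = (pohCells e).linkDegSum s i +
      if s.reduced i = n then 0 else 8 + (if s.reduced (i + 1) = 1 - n then 4 else 8) +
        if s.reduced (i + 2) = 1 - n then 4 else 8 := by
  rw [CellDecomposition.nbrDegSum_outer]
  change _ + (s.nbr i).elim 0 _ = _
  split_ifs with h
  · rw [HoneycombVertex.nbr_eq_none_iff.2 h, Option.elim_none]
  all_goals
    obtain ⟨t, ht⟩ := Option.ne_none_iff_exists'.1 (mt HoneycombVertex.nbr_eq_none_iff.1 h)
    rw [ht, Option.elim_some, linkDegSum_pohCells_of_nbr_eq_some e ht]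
    simp only [*, if_true, if_false]

lemma octahedronSum_vdeg {M : Type*} [AddCommMonoid M] (F : Sym2 ℝ → M) (s : HoneycombVertex n) :
    octahedronSum (fun d => F (d.map (vdeg G))) (fun i => (pohCells e).corner s (false, i))
      (fun i => (pohCells e).corner s (true, i)) =
      if ∃ i, s.reduced i = n then octahedronSum F ![4, 8, 8] ![4, 4, 4]
      else octahedronSum F ![8, 8, 8] ![4, 4, 4] := by
  rw [octahedronSum_map]
  simp only [CellDecomposition.vdeg_outer, CellDecomposition.vdeg_inner, outerDeg_pohCells]
  split_ifs with h
  · obtain ⟨i, hi⟩ := h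
    have ne₁ : s.reduced (i + 1) ≠ n := fun h => by
      simpa using s.eq_of_reduced_eq_max h hi
    have ne₂ : s.reduced (i + 2) ≠ n := fun h => by
      simpa using s.eq_of_reduced_eq_max h hi
    rw [octahedronSum_eq_rotate _ _ _ i]
    simp only [hi, ne₁, ne₂, if_true, if_false]
  · push Not at h
    rw [octahedronSum_eq_rotate _ _ _ 0]
    simp only [h, if_false]

lemma octahedronSum_nbrDegSum_of_eq_max {M : Type*} [AddCommMonoid M] (F : Sym2 ℝ → M) (hn : 2 ≤ n)
    (hi : s.reduced i = n) :
    octahedronSum (fun d => F (d.map (nbrDegSum G))) (fun i => (pohCells e).corner s (false, i))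
      (fun i => (pohCells e).corner s (true, i)) =
      if ∃ i, s.reduced i = 1 - n then octahedronSum F ![24, 44, 40] ![24, 20, 20]
      else octahedronSum F ![24, 44, 44] ![24, 20, 20] := by
  have ne_min : (n : ℤ) ≠ 1 - n := by omega
  have ne_max (j : Fin 3) (hj : j ≠ i) : s.reduced j ≠ n :=
    fun h => hj (s.eq_of_reduced_eq_max h hi)
  rw [octahedronSum_map, octahedronSum_eq_rotate _ _ _ i]
  simp only [nbrDegSum_outer_pohCells, CellDecomposition.nbrDegSum_inner, linkDegSum_pohCells,
    add_assoc i, Fin.reduceAdd, add_zero, hi, ne_max (i + 1) (by simp), ne_max (i + 2) (by simp),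
    ne_min, if_true, if_false]
  by_cases h₁ : s.reduced (i + 1) = 1 - n
  · have h₂ : s.reduced (i + 2) ≠ 1 - n := fun h₂ => by
      simpa using s.eq_of_reduced_eq_min hn h₁ h₂
    rw [if_pos (⟨_, h₁⟩ : ∃ j, s.reduced j = 1 - n)]
    norm_num [h₁, h₂]
  by_cases h₂ : s.reduced (i + 2) = 1 - n
  · rw [if_pos (⟨_, h₂⟩ : ∃ j, s.reduced j = 1 - n), octahedronSum_swap]
    norm_num [h₁, h₂]
  · have ne_min' : ¬∃ j, s.reduced j = 1 - n := by
      rintro ⟨j, hj⟩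
      obtain rfl | rfl | rfl := eq_or_eq_add_one_or_eq_add_two i j
      exacts [ne_min (hi.symm.trans hj), h₁ hj, h₂ hj]
    rw [if_neg ne_min']
    norm_num [h₁, h₂]

lemma octahedronSum_nbrDegSum_of_forall_ne_max {M : Type*} [AddCommMonoid M] (F : Sym2 ℝ → M)
    (hn : 2 ≤ n) (ne_max : ∀ i, s.reduced i ≠ n) :
    octahedronSum (fun d => F (d.map (nbrDegSum G))) (fun i => (pohCells e).corner s (false, i))
      (fun i => (pohCells e).corner s (true, i)) =
      if ∃ i, s.reduced i = 1 - n then octahedronSum F ![48, 44, 44] ![24, 24, 24]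
      else octahedronSum F ![48, 48, 48] ![24, 24, 24] := by
  rw [octahedronSum_map]
  simp only [nbrDegSum_outer_pohCells, CellDecomposition.nbrDegSum_inner, linkDegSum_pohCells,
    ne_max, if_false]
  split_ifs with h
  · obtain ⟨i, hi⟩ := h
    have ne_min (j : Fin 3) (hj : j ≠ i) : s.reduced j ≠ 1 - n :=
      fun h => hj (s.eq_of_reduced_eq_min hn h hi)
    rw [octahedronSum_eq_rotate _ _ _ i]
    simp only [add_assoc i, Fin.reduceAdd, add_zero, hi, ne_min (i + 1) (by simp),
      ne_min (i + 2) (by simp), if_true, if_false]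
    norm_num
  · push Not at h
    rw [octahedronSum_eq_rotate _ _ _ 0]
    simp only [h, if_false]
    norm_num

lemma octahedronSum_nbrDegSum {M : Type*} [AddCommMonoid M] (F : Sym2 ℝ → M) (hn : 2 ≤ n)
    (s : HoneycombVertex n) :
    octahedronSum (fun d => F (d.map (nbrDegSum G))) (fun i => (pohCells e).corner s (false, i))
      (fun i => (pohCells e).corner s (true, i)) =
      if ∃ i, s.reduced i = n then
        if ∃ i, s.reduced i = 1 - n then octahedronSum F ![24, 44, 40] ![24, 20, 20]
        else octahedronSum F ![24, 44, 44] ![24, 20, 20]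
      else
        if ∃ i, s.reduced i = 1 - n then octahedronSum F ![48, 44, 44] ![24, 24, 24]
        else octahedronSum F ![48, 48, 48] ![24, 24, 24] := by
  by_cases hmax : ∃ i, s.reduced i = n
  · rw [if_pos hmax]
    obtain ⟨i, hi⟩ := hmax
    exact octahedronSum_nbrDegSum_of_eq_max e F hn hi
  · rw [if_neg hmax]
    exact octahedronSum_nbrDegSum_of_forall_ne_max e F hn (not_exists.1 hmax)

variable [Fintype G.edgeSet]

include e

lemma sum_edgeFinset_vdeg (F : Sym2 ℝ → ℝ) :
    ∑ d ∈ G.edgeFinset, F (d.map (vdeg G)) =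
      6 * n * ((3 * n + 2) * F s(4, 4) + 6 * n * F s(4, 8) + (3 * n - 2) * F s(8, 8)) := by
  have := Fintype.ofFinite (HoneycombVertex n)
  rw [(pohCells e).sum_edgeFinset fun d => F (d.map (vdeg G))]
  simp only [octahedronSum_vdeg, sum_ite_const, HoneycombVertex.card_eq,
    HoneycombVertex.card_filter_exists_eq_max]
  simp only [octahedronSum, Fin.sum_univ_three, Fin.reduceAdd, Matrix.cons_val,
    Sym2.eq_swap (a := (8 : ℝ)) (b := 4), Nat.cast_mul, Nat.cast_ofNat, Nat.cast_pow]
  ring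

lemma sum_edgeFinset_nbrDegSum (hn : 2 ≤ n) (F : Sym2 ℝ → ℝ) :
    ∑ d ∈ G.edgeFinset, F (d.map (nbrDegSum G)) =
      6 * n * F s(20, 20) + 24 * n * F s(20, 24) + 12 * F s(20, 40) +
        12 * (n - 1) * F s(20, 44) + 18 * n * (n - 1) * F s(24, 24) + 24 * F s(24, 40) +
        48 * (n - 1) * F s(24, 44) + 12 * (n - 1) * (3 * n - 2) * F s(24, 48) +
        12 * F s(40, 44) + 6 * (2 * n - 3) * F s(44, 44) + 12 * (n - 1) * F s(44, 48) +
        18 * (n - 1) ^ 2 * F s(48, 48) := by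
  have := Fintype.ofFinite (HoneycombVertex n)
  rw [(pohCells e).sum_edgeFinset fun d => F (d.map (nbrDegSum G))]
  simp only [octahedronSum_nbrDegSum e F hn, sum_ite_ite_const, HoneycombVertex.card_eq,
    HoneycombVertex.card_filter_exists_eq_max, HoneycombVertex.card_filter_exists_eq_min hn,
    HoneycombVertex.card_filter_exists_eq_max_and_eq_min hn]
  simp only [octahedronSum, Fin.sum_univ_three, Fin.reduceAdd, Matrix.cons_val,
    Sym2.eq_swap (a := (24 : ℝ)) (b := 20), Sym2.eq_swap (a := (44 : ℝ)) (b := 20),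
    Sym2.eq_swap (a := (40 : ℝ)) (b := 24), Sym2.eq_swap (a := (44 : ℝ)) (b := 24),
    Sym2.eq_swap (a := (48 : ℝ)) (b := 24), Sym2.eq_swap (a := (44 : ℝ)) (b := 40),
    Sym2.eq_swap (a := (48 : ℝ)) (b := 44), Nat.cast_mul, Nat.cast_ofNat, Nat.cast_pow,
    Nat.cast_add, Nat.cast_one]
  ring

end

/-! ### The four indices -/

/-- The contribution of an edge to `abcIndex` or `abc4Index`, as a function of the unordered pair of
labels `vdeg` or `nbrDegSum` of its endpoints. -/
noncomputable def abcWeight : Sym2 ℝ → ℝ :=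
  Sym2.lift ⟨fun x y => √((x + y - 2) / (x * y)), fun x y => by simp only [add_comm, mul_comm]⟩

/-- The contribution of an edge to `gaIndex` or `ga5Index`, as a function of the unordered pair of
labels `vdeg` or `nbrDegSum` of its endpoints. -/
noncomputable def gaWeight : Sym2 ℝ → ℝ :=
  Sym2.lift ⟨fun x y => 2 * √(x * y) / (x + y), fun x y => by simp only [add_comm, mul_comm]⟩

section

variable {x y c m : ℝ}

lemma abcWeight_mk (x y : ℝ) : abcWeight s(x, y) = √((x + y - 2) / (x * y)) := rfl

lemma gaWeight_mk (x y : ℝ) : gaWeight s(x, y) = 2 * √(x * y) / (x + y) := rfl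

lemma abcWeight_eq_mul_sqrt (hc : 0 ≤ c) (h : (x + y - 2) / (x * y) = c ^ 2 * m) :
    abcWeight s(x, y) = c * √m := by
  rw [abcWeight_mk, h, Real.sqrt_mul (sq_nonneg c), Real.sqrt_sq hc]

lemma gaWeight_eq_mul_sqrt (hc : 0 ≤ c) (hxy : 0 < x + y)
    (h : x * y = (c * (x + y) / 2) ^ 2 * m) : gaWeight s(x, y) = c * √m := by
  rw [gaWeight_mk, h, Real.sqrt_mul (sq_nonneg _), Real.sqrt_sq (by positivity)]
  field_simp

lemma gaWeight_self (hx : 0 < x) : gaWeight s(x, x) = 1 := by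
  rw [gaWeight_mk, Real.sqrt_mul_self hx.le, two_mul, div_self (by positivity)]

end

section

variable {V : Type*} [Fintype V] (G : SimpleGraph V)

open Classical in
lemma abcIndex_eq_sum_abcWeight :
    abcIndex G = ∑ d ∈ G.edgeFinset, abcWeight (d.map (vdeg G)) :=
  Finset.sum_congr rfl fun d _ => d.ind fun _ _ => rfl

open Classical in
lemma gaIndex_eq_sum_gaWeight :
    gaIndex G = ∑ d ∈ G.edgeFinset, gaWeight (d.map (vdeg G)) :=
  Finset.sum_congr rfl fun d _ => d.ind fun _ _ => rfl

open Classical in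
lemma abc4Index_eq_sum_abcWeight :
    abc4Index G = ∑ d ∈ G.edgeFinset, abcWeight (d.map (nbrDegSum G)) :=
  Finset.sum_congr rfl fun d _ => d.ind fun _ _ => rfl

open Classical in
lemma ga5Index_eq_sum_gaWeight :
    ga5Index G = ∑ d ∈ G.edgeFinset, gaWeight (d.map (nbrDegSum G)) :=
  Finset.sum_congr rfl fun d _ => d.ind fun _ _ => rfl

end

section

variable {n : ℕ} {V : Type*} [Fintype V] {G : SimpleGraph V} (e : G ≃g POH n)

include e

lemma abcIndex_of_iso_POH :
    abcIndex G = 3 / 4 * (n : ℝ) *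
        (4 * √6 - 2 * √14 + 3 * (4 * √5 + 2 * √6 + √14) * (n : ℝ)) := by
  have abc_4_4 : abcWeight s(4, 4) = 1 / 4 * √6 := abcWeight_eq_mul_sqrt (by norm_num) (by norm_num)
  have abc_4_8 : abcWeight s(4, 8) = 1 / 4 * √5 := abcWeight_eq_mul_sqrt (by norm_num) (by norm_num)
  have abc_8_8 : abcWeight s(8, 8) = 1 / 8 * √14 :=
    abcWeight_eq_mul_sqrt (by norm_num) (by norm_num)
  classical
  rw [abcIndex_eq_sum_abcWeight, sum_edgeFinset_vdeg e, abc_4_4, abc_4_8, abc_8_8]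
  ring

lemma gaIndex_of_iso_POH :
    gaIndex G = 12 * (3 + 2 * √2) * (n : ℝ) ^ 2 := by
  have ga_4_4 : gaWeight s(4, 4) = 1 := gaWeight_self (by norm_num)
  have ga_4_8 : gaWeight s(4, 8) = 2 / 3 * √2 :=
    gaWeight_eq_mul_sqrt (by norm_num) (by norm_num) (by norm_num)
  have ga_8_8 : gaWeight s(8, 8) = 1 := gaWeight_self (by norm_num)
  classical
  rw [gaIndex_eq_sum_gaWeight, sum_edgeFinset_vdeg e, ga_4_4, ga_4_8, ga_8_8]
  ring

lemma abc4Index_of_iso_POH (hn : 2 ≤ n) :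
    abc4Index G = 1 / 440 *
        (264 * √29 + 88 * √930 + 24 * √2255 + 5280 * (-1 + (n : ℝ))
          + 60 * √330 * (-1 + (n : ℝ)) + 24 * √3410 * (-1 + (n : ℝ))
          + 165 * √94 * (-1 + (n : ℝ)) ^ 2 + 528 * √35 * (n : ℝ) + 132 * √38 * (n : ℝ)
          + 330 * √46 * (-1 + (n : ℝ)) * (n : ℝ) + 60 * √86 * (-3 + 2 * (n : ℝ))
          + 220 * √35 * (2 - 5 * (n : ℝ) + 3 * (n : ℝ) ^ 2)) := by
  have abc_20_20 : abcWeight s(20, 20) = 1 / 20 * √38 :=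
    abcWeight_eq_mul_sqrt (by norm_num) (by norm_num)
  have abc_20_24 : abcWeight s(20, 24) = 1 / 20 * √35 :=
    abcWeight_eq_mul_sqrt (by norm_num) (by norm_num)
  have abc_20_40 : abcWeight s(20, 40) = 1 / 20 * √29 :=
    abcWeight_eq_mul_sqrt (by norm_num) (by norm_num)
  have abc_20_44 : abcWeight s(20, 44) = 1 / 220 * √3410 :=
    abcWeight_eq_mul_sqrt (by norm_num) (by norm_num)
  have abc_24_24 : abcWeight s(24, 24) = 1 / 24 * √46 :=
    abcWeight_eq_mul_sqrt (by norm_num) (by norm_num)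
  have abc_24_40 : abcWeight s(24, 40) = 1 / 120 * √930 :=
    abcWeight_eq_mul_sqrt (by norm_num) (by norm_num)
  have abc_24_44 : abcWeight s(24, 44) = 1 / 4 := by
    rw [abcWeight_eq_mul_sqrt (c := 1 / 4) (m := 1) (by norm_num) (by norm_num), Real.sqrt_one,
      mul_one]
  have abc_24_48 : abcWeight s(24, 48) = 1 / 24 * √35 :=
    abcWeight_eq_mul_sqrt (by norm_num) (by norm_num)
  have abc_40_44 : abcWeight s(40, 44) = 1 / 220 * √2255 :=
    abcWeight_eq_mul_sqrt (by norm_num) (by norm_num)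
  have abc_44_44 : abcWeight s(44, 44) = 1 / 44 * √86 :=
    abcWeight_eq_mul_sqrt (by norm_num) (by norm_num)
  have abc_44_48 : abcWeight s(44, 48) = 1 / 88 * √330 :=
    abcWeight_eq_mul_sqrt (by norm_num) (by norm_num)
  have abc_48_48 : abcWeight s(48, 48) = 1 / 48 * √94 :=
    abcWeight_eq_mul_sqrt (by norm_num) (by norm_num)
  classical
  rw [abc4Index_eq_sum_abcWeight, sum_edgeFinset_nbrDegSum e hn, abc_20_20, abc_20_24, abc_20_40,
    abc_20_44, abc_24_24, abc_24_40, abc_24_44, abc_24_48, abc_40_44, abc_44_44, abc_44_48,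
    abc_48_48]
  ring

lemma ga5Index_of_iso_POH (hn : 2 ≤ n) :
    ga5Index G = 8 * √2 + 6 * √15 + 8 / 7 * √110 + 48 / 23 * √33 * (-1 + (n : ℝ))
          + 3 / 2 * √55 * (-1 + (n : ℝ)) + 96 / 17 * √66 * (-1 + (n : ℝ)) - 36 * (n : ℝ)
          + 48 / 11 * √30 * (n : ℝ) + 36 * (n : ℝ) ^ 2
          + 8 * √2 * (2 - 5 * (n : ℝ) + 3 * (n : ℝ) ^ 2) := by
  have ga_20_20 : gaWeight s(20, 20) = 1 := gaWeight_self (by norm_num)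
  have ga_20_24 : gaWeight s(20, 24) = 2 / 11 * √30 :=
    gaWeight_eq_mul_sqrt (by norm_num) (by norm_num) (by norm_num)
  have ga_20_40 : gaWeight s(20, 40) = 2 / 3 * √2 :=
    gaWeight_eq_mul_sqrt (by norm_num) (by norm_num) (by norm_num)
  have ga_20_44 : gaWeight s(20, 44) = 1 / 8 * √55 :=
    gaWeight_eq_mul_sqrt (by norm_num) (by norm_num) (by norm_num)
  have ga_24_24 : gaWeight s(24, 24) = 1 := gaWeight_self (by norm_num)
  have ga_24_40 : gaWeight s(24, 40) = 1 / 4 * √15 :=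
    gaWeight_eq_mul_sqrt (by norm_num) (by norm_num) (by norm_num)
  have ga_24_44 : gaWeight s(24, 44) = 2 / 17 * √66 :=
    gaWeight_eq_mul_sqrt (by norm_num) (by norm_num) (by norm_num)
  have ga_24_48 : gaWeight s(24, 48) = 2 / 3 * √2 :=
    gaWeight_eq_mul_sqrt (by norm_num) (by norm_num) (by norm_num)
  have ga_40_44 : gaWeight s(40, 44) = 2 / 21 * √110 :=
    gaWeight_eq_mul_sqrt (by norm_num) (by norm_num) (by norm_num)
  have ga_44_44 : gaWeight s(44, 44) = 1 := gaWeight_self (by norm_num)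
  have ga_44_48 : gaWeight s(44, 48) = 4 / 23 * √33 :=
    gaWeight_eq_mul_sqrt (by norm_num) (by norm_num) (by norm_num)
  have ga_48_48 : gaWeight s(48, 48) = 1 := gaWeight_self (by norm_num)
  classical
  rw [ga5Index_eq_sum_gaWeight, sum_edgeFinset_nbrDegSum e hn, ga_20_20, ga_20_24, ga_20_40,
    ga_20_44, ga_24_24, ga_24_40, ga_24_44, ga_24_48, ga_40_44, ga_44_44, ga_44_48, ga_48_48]
  ring

end

theorem theorem3 (n : ℕ) {V : Type*} [Fintype V] (G : SimpleGraph V)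
    (hG : Nonempty (G ≃g POH n)) :
    abcIndex G = 3 / 4 * (n : ℝ) *
        (4 * √6 - 2 * √14 + 3 * (4 * √5 + 2 * √6 + √14) * (n : ℝ)) ∧
    gaIndex G = 12 * (3 + 2 * √2) * (n : ℝ) ^ 2 ∧
    (2 ≤ n →
      abc4Index G = 1 / 440 *
        (264 * √29 + 88 * √930 + 24 * √2255 + 5280 * (-1 + (n : ℝ))
          + 60 * √330 * (-1 + (n : ℝ)) + 24 * √3410 * (-1 + (n : ℝ))
          + 165 * √94 * (-1 + (n : ℝ)) ^ 2 + 528 * √35 * (n : ℝ) + 132 * √38 * (n : ℝ)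
          + 330 * √46 * (-1 + (n : ℝ)) * (n : ℝ) + 60 * √86 * (-3 + 2 * (n : ℝ))
          + 220 * √35 * (2 - 5 * (n : ℝ) + 3 * (n : ℝ) ^ 2)) ∧
      ga5Index G = 8 * √2 + 6 * √15 + 8 / 7 * √110 + 48 / 23 * √33 * (-1 + (n : ℝ))
          + 3 / 2 * √55 * (-1 + (n : ℝ)) + 96 / 17 * √66 * (-1 + (n : ℝ)) - 36 * (n : ℝ)
          + 48 / 11 * √30 * (n : ℝ) + 36 * (n : ℝ) ^ 2
          + 8 * √2 * (2 - 5 * (n : ℝ) + 3 * (n : ℝ) ^ 2)) := by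
  obtain ⟨e⟩ := hG
  exact ⟨abcIndex_of_iso_POH e, gaIndex_of_iso_POH e,
    fun hn => ⟨abc4Index_of_iso_POH e hn, ga5Index_of_iso_POH e hn⟩⟩
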